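/- A partition of $n$ is a non-increasing sequence $\lambda_1\ge\lambda_2\ge\cdots\ge\lambda_s$ of positive integers with sum $n$. For integers $n,i,j\ge 0$, let $\mathcal{C}^*(n;i,j)$ denote the number of partitions of $n$ into parts greater than $1$ such that 1. $\lambda_k-\lambda_{k+1}\ge 2$ for all $1\le k<s$; 2. $\lambda_k-\lambda_{k+1}\ge 5$ whenever $1\le k<s$ and neither $\lambda_k$ nor $\lambda_k+\lambda_{k+1}$ is divisible by $3$; 3. there is no $k$ with $1\le k\le s-2$ and $\lambda_k-\lambda_{k+1}=\lambda_{k+1}-\lambda_{k+2}=2$; and such that exactly $i$ parts are congruent to $1$ modulo $3$ and exactly $j$ parts are congruent to $2$ modulo $3$. Let $\mathcal{D}(n;i,j)$ denote the number of partitions of $n$ into distinct parts not congruent to $\pm1$ modulo $6$, with exactly $i$ parts congruent to $1$ modulo $3$ and exactly $j$ parts congruent to $2$ modulo $3$. Then for all $n,i,j\ge 0$, $$\mathcal{C}^*(n;i,j)=\mathcal{D}(n;i,j).$$ -/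

import Mathlib

namespace Capparelli

/-- The parts of a partition of `n`, written as a non-increasing sequence. -/
def descParts {n : ℕ} (p : n.Partition) : List ℕ :=
  p.parts.sort (· ≥ ·)

/-- The conditions defining the partitions counted by `C*(n)`. Here `[x, y] <:+: l` says that
`x, y` occur as consecutive entries of the list `l`, so `x` is the larger part. -/
structure IsCStar {n : ℕ} (p : n.Partition) : Prop where
  one_lt : ∀ m ∈ p.parts, 1 < m
  diff_ge_two : ∀ x y : ℕ, [x, y] <:+: descParts p → y + 2 ≤ x
  diff_ge_five : ∀ x y : ℕ, [x, y] <:+: descParts p →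
    ¬ 3 ∣ x → ¬ 3 ∣ x + y → y + 5 ≤ x
  no_triple : ∀ x y z : ℕ, [x, y, z] <:+: descParts p → ¬ (x = y + 2 ∧ y = z + 2)

/-- Partitions into distinct parts not congruent to `± 1` modulo `6`. -/
structure IsD {n : ℕ} (p : n.Partition) : Prop where
  nodup : p.parts.Nodup
  not_one : ∀ m ∈ p.parts, ¬ m ≡ 1 [MOD 6]
  not_neg_one : ∀ m ∈ p.parts, ¬ m ≡ 5 [MOD 6]

/-- The number of parts (with multiplicity) congruent to `r` modulo `3`. -/
def numPartsMod3 {n : ℕ} (r : ℕ) (p : n.Partition) : ℕ :=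
  p.parts.countP (fun m => m ≡ r [MOD 3])

/-- `C*(n; i, j)`. -/
noncomputable def cStar (n i j : ℕ) : ℕ :=
  Nat.card {p : n.Partition // IsCStar p ∧ numPartsMod3 1 p = i ∧ numPartsMod3 2 p = j}

/-- `D(n; i, j)`. -/
noncomputable def dCount (n i j : ℕ) : ℕ :=
  Nat.card {p : n.Partition // IsD p ∧ numPartsMod3 1 p = i ∧ numPartsMod3 2 p = j}

end Capparelli

namespace Capparelli

open PowerSeries

/-! Write parts in increasing order and also fix the number `k` of multiples of 3. Adding 3 to every
part preserves residues and difference conditions, and with the number of parts fixed it multiplies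
the generating function by a monomial. Removing the smallest part and shifting therefore gives
linear recurrences for the C* lists, solved by `closedForm` (`gf_good_eq_closedForm`). Shifts by 6
give in the same way the product T = `progTerm 6 4 i * progTerm 6 2 j * progTerm 3 3 k` on the D
side (`gf_distinctGE_eq_progTerm`).

With q = X^3 and m = i + j, `closedForm` is T times (-q; q)_m q^(km), so the two sides agree only
after summing over `k`. By Euler's expansion, ∑_k q^(km) `progTerm 3 3 k` = (-q^(m+1); q)_∞, and the
factor (-q; q)_m completes it to (-q; q)_∞, the D-side sum. Only coefficients up to X^n matter, so
`X_pow_dvd_oneAddProd_mul_sum_sub` uses truncated sums. -/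

/-! ### Generating functions of sets of lists -/

/-- The number of entries of a list congruent to `r` modulo `3`. -/
def residueCount (r : ℕ) (l : List ℕ) : ℕ :=
  l.countP (fun m => m ≡ r [MOD 3])

/-- The lists in `P` with sum `n` and prescribed numbers of entries in each class modulo `3`. -/
def fiber (P : Set (List ℕ)) (i j k n : ℕ) : Set (List ℕ) :=
  {l | l ∈ P ∧ l.sum = n ∧ residueCount 1 l = i ∧ residueCount 2 l = j ∧ residueCount 0 l = k}

/-- The generating function, by sum, of the lists in `P` with `i`, `j`, `k` entries congruent to
`1`, `2`, `0` modulo `3`. -/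
noncomputable def gf (P : Set (List ℕ)) (i j k : ℕ) : ℤ⟦X⟧ :=
  PowerSeries.mk fun n => ((fiber P i j k n).ncard : ℤ)

theorem residueCount_cons (r a : ℕ) (l : List ℕ) :
    residueCount r (a :: l) = residueCount r l + if a ≡ r [MOD 3] then 1 else 0 := by
  simp [residueCount, List.countP_cons]

theorem length_eq_residueCount (l : List ℕ) :
    l.length = residueCount 1 l + residueCount 2 l + residueCount 0 l := by
  induction l with
  | nil => simp [residueCount]
  | cons a l ih =>
    have h : a % 3 = 0 ∨ a % 3 = 1 ∨ a % 3 = 2 := by omega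
    simp only [residueCount_cons, List.length_cons, ih, Nat.ModEq]
    rcases h with h | h | h <;> simp [h] <;> omega

theorem residueCount_map_add {d : ℕ} (hd : 3 ∣ d) (r : ℕ) (l : List ℕ) :
    residueCount r (l.map (· + d)) = residueCount r l := by
  induction l with
  | nil => rfl
  | cons a l ih =>
    have : a + d ≡ r [MOD 3] ↔ a ≡ r [MOD 3] := by
      simp only [Nat.ModEq]; omega
    simp [residueCount_cons, ih, this]

theorem sum_map_add (d : ℕ) (l : List ℕ) : (l.map (· + d)).sum = l.sum + d * l.length := by
  induction l with
  | nil => simp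
  | cons a l ih => simp [ih]; ring

/-- Length and entries are both bounded. Finiteness is what makes `ncard` additive on disjoint
unions. -/
theorem finite_fiber (P : Set (List ℕ)) (i j k n : ℕ) : (fiber P i j k n).Finite := by
  refine ((List.finite_length_eq (Fin (n + 1)) (i + j + k)).image (List.map Fin.val)).subset ?_
  rintro l ⟨-, hn, hi, hj, hk⟩
  have hle : ∀ x ∈ l, x < n + 1 := fun x hx => by
    have := List.single_le_sum (fun _ _ => Nat.zero_le _) x hx
    omega
  refine ⟨l.pmap (fun x hx => (⟨x, hx⟩ : Fin (n + 1))) hle, ?_, ?_⟩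
  · simp [length_eq_residueCount, hi, hj, hk]
  · simp [List.map_pmap]

theorem gf_union {P Q : Set (List ℕ)} (h : Disjoint P Q) (i j k : ℕ) :
    gf (P ∪ Q) i j k = gf P i j k + gf Q i j k := by
  ext n
  have hu : fiber (P ∪ Q) i j k n = fiber P i j k n ∪ fiber Q i j k n := by
    ext l; simp only [fiber, Set.mem_union, Set.mem_ofPred_eq]; tauto
  simp only [gf, map_add, coeff_mk, hu]
  rw [Set.ncard_union_eq _ (finite_fiber _ _ _ _ _) (finite_fiber _ _ _ _ _)]
  · push_cast; rfl
  · exact h.mono (fun _ h => h.1) (fun _ h => h.1)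

/-- Covers both operations of the proof, prepending a part and translating all parts. The change of
sum need only be constant at fixed length, since a translation by `d` adds `d` per part. -/
theorem gf_image {P : Set (List ℕ)} {f : List ℕ → List ℕ} (hf : f.Injective)
    {i j k i' j' k' c : ℕ}
    (hr : ∀ l, (residueCount 1 (f l) = i' ∧ residueCount 2 (f l) = j' ∧ residueCount 0 (f l) = k') ↔
      (residueCount 1 l = i ∧ residueCount 2 l = j ∧ residueCount 0 l = k))
    (hs : ∀ l, l.length = i + j + k → (f l).sum = l.sum + c) :
    gf (f '' P) i' j' k' = X ^ c * gf P i j k := by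
  have hs' : ∀ l, residueCount 1 l = i → residueCount 2 l = j → residueCount 0 l = k →
      (f l).sum = l.sum + c := fun l h1 h2 h3 => hs l (by rw [length_eq_residueCount, h1, h2, h3])
  ext n
  rw [coeff_X_pow_mul']
  split_ifs with hc
  · have : fiber (f '' P) i' j' k' n = f '' fiber P i j k (n - c) := by
      ext l
      constructor
      · rintro ⟨⟨l, hl, rfl⟩, hn, hijk⟩
        obtain ⟨h1, h2, h3⟩ := (hr l).1 hijk
        exact ⟨l, ⟨hl, by have := hs' l h1 h2 h3; omega, h1, h2, h3⟩, rfl⟩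
      · rintro ⟨l, ⟨hl, hn, h1, h2, h3⟩, rfl⟩
        exact ⟨⟨l, hl, rfl⟩, by have := hs' l h1 h2 h3; omega, (hr l).2 ⟨h1, h2, h3⟩⟩
    simp only [gf, coeff_mk, this, Set.ncard_image_of_injective _ hf]
  · have : fiber (f '' P) i' j' k' n = ∅ := by
      refine Set.eq_empty_of_forall_notMem ?_
      rintro _ ⟨⟨l, hl, rfl⟩, hn, hijk⟩
      obtain ⟨h1, h2, h3⟩ := (hr l).1 hijk
      have := hs' l h1 h2 h3
      omega
    simp [gf, this]

theorem gf_shift (P : Set (List ℕ)) {d : ℕ} (hd : 3 ∣ d) (i j k : ℕ) :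
    gf (List.map (· + d) '' P) i j k = X ^ (d * (i + j + k)) * gf P i j k := by
  refine gf_image (List.map_injective_iff.2 (add_left_injective d)) (fun l => ?_) (fun l hl => ?_)
  · simp only [residueCount_map_add hd]
  · rw [sum_map_add, hl]

theorem gf_eq_zero {P : Set (List ℕ)} {i j k : ℕ}
    (h : ∀ l ∈ P, ¬ (residueCount 1 l = i ∧ residueCount 2 l = j ∧ residueCount 0 l = k)) :
    gf P i j k = 0 := by
  ext n
  have : fiber P i j k n = ∅ :=
    Set.eq_empty_of_forall_notMem fun l hl => h l hl.1 hl.2.2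
  simp [gf, this]

section Cons

variable (P : Set (List ℕ)) {a : ℕ} (i j k : ℕ)

theorem gf_cons_one (ha : a % 3 = 1) :
    gf (List.cons a '' P) (i + 1) j k = X ^ a * gf P i j k := by
  refine gf_image List.cons_injective (fun l => ?_) (fun l _ => by simp [add_comm])
  simp [residueCount_cons, Nat.ModEq, ha]

theorem gf_cons_two (ha : a % 3 = 2) :
    gf (List.cons a '' P) i (j + 1) k = X ^ a * gf P i j k := by
  refine gf_image List.cons_injective (fun l => ?_) (fun l _ => by simp [add_comm])
  simp [residueCount_cons, Nat.ModEq, ha]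

theorem gf_cons_three (ha : a % 3 = 0) :
    gf (List.cons a '' P) i j (k + 1) = X ^ a * gf P i j k := by
  refine gf_image List.cons_injective (fun l => ?_) (fun l _ => by simp [add_comm])
  simp [residueCount_cons, Nat.ModEq, ha]

theorem gf_cons_one_zero (ha : a % 3 = 1) : gf (List.cons a '' P) 0 j k = 0 := by
  refine gf_eq_zero ?_
  rintro _ ⟨l, -, rfl⟩
  simp [residueCount_cons, Nat.ModEq, ha]

theorem gf_cons_two_zero (ha : a % 3 = 2) : gf (List.cons a '' P) i 0 k = 0 := by
  refine gf_eq_zero ?_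
  rintro _ ⟨l, -, rfl⟩
  simp [residueCount_cons, Nat.ModEq, ha]

theorem gf_cons_three_zero (ha : a % 3 = 0) : gf (List.cons a '' P) i j 0 = 0 := by
  refine gf_eq_zero ?_
  rintro _ ⟨l, -, rfl⟩
  simp [residueCount_cons, Nat.ModEq, ha]

end Cons

theorem gf_zero {P : Set (List ℕ)} (h : [] ∈ P) : gf P 0 0 0 = 1 := by
  ext n
  have hnil : ∀ l ∈ fiber P 0 0 0 n, l = [] := by
    rintro l ⟨-, -, h1, h2, h3⟩
    rw [← List.length_eq_zero_iff, length_eq_residueCount, h1, h2, h3]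
  rw [coeff_one]
  split_ifs with hn
  · have : fiber P 0 0 0 n = {[]} := by
      refine Set.eq_singleton_iff_unique_mem.2 ⟨⟨h, ?_⟩, hnil⟩
      simp [hn, residueCount]
    simp [gf, this]
  · have : fiber P 0 0 0 n = ∅ := by
      refine Set.eq_empty_of_forall_notMem fun l hl => hn ?_
      have := hl.2.1
      rw [hnil l hl] at this
      simpa using this.symm
    simp [gf, this]

/-! ### Lists satisfying the C* conditions, and their smallest part -/

/-- The admissibility of `x` as the part following the smaller part `y`. -/
def Adm (y x : ℕ) : Prop :=
  y + 2 ≤ x ∧ (¬ 3 ∣ x → ¬ 3 ∣ x + y → y + 5 ≤ x)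

/-- The difference conditions of `IsCStar`, for a list written in increasing order. -/
def Good : List ℕ → Prop
  | [] => True
  | [_] => True
  | x :: y :: l => Adm x y ∧ (∀ z ∈ l.head?, ¬ (y = x + 2 ∧ z = y + 2)) ∧ Good (y :: l)

/-- The good lists whose entries are at least `t`. -/
def goodGE (t : ℕ) : Set (List ℕ) := {l | Good l ∧ ∀ y ∈ l.head?, t ≤ y}

/-- The good lists whose first entry is `t`. -/
def goodEQ (t : ℕ) : Set (List ℕ) := {l | Good l ∧ l.head? = some t}

theorem Good.tail {x : ℕ} {l : List ℕ} (h : Good (x :: l)) : Good l := by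
  cases l with
  | nil => trivial
  | cons y l => exact h.2.2

theorem Good.le_of_mem {x : ℕ} {l : List ℕ} (h : Good (x :: l)) : ∀ y ∈ x :: l, x ≤ y := by
  induction l generalizing x with
  | nil => simp
  | cons z l ih =>
    intro y hy
    rcases List.mem_cons.1 hy with rfl | hy
    · exact le_rfl
    · have := ih h.tail y hy
      have := h.1.1
      omega

theorem Good.isChain {l : List ℕ} (h : Good l) : l.IsChain (· < ·) := by
  induction l with
  | nil => simp
  | cons x l ih =>
    cases l with
    | nil => simp
    | cons y l =>
      have := h.1.1
      exact List.isChain_cons_cons.2 ⟨by omega, ih h.tail⟩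

theorem good_map_add_three (l : List ℕ) : Good (l.map (· + 3)) ↔ Good l := by
  induction l with
  | nil => rfl
  | cons x l ih =>
    cases l with
    | nil => rfl
    | cons y l =>
      have hA : Adm (x + 3) (y + 3) ↔ Adm x y := by unfold Adm; omega
      have hz : (∀ z ∈ (l.map (· + 3)).head?, ¬ (y + 3 = x + 3 + 2 ∧ z = y + 3 + 2)) ↔
          ∀ z ∈ l.head?, ¬ (y = x + 2 ∧ z = y + 2) := by
        cases l with
        | nil => simp
        | cons z l => simp
      simp only [List.map_cons] at ih ⊢
      simp only [Good]
      rw [hA, hz, ih]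

theorem exists_map_add {d : ℕ} {l : List ℕ} (h : ∀ x ∈ l, d ≤ x) : ∃ l' : List ℕ, l'.map (· + d) = l := by
  refine ⟨l.map (· - d), ?_⟩
  rw [List.map_map]
  conv_rhs => rw [← List.map_id l]
  exact List.map_congr_left fun x hx => by have := h x hx; simp; omega

theorem exists_good_map_add_three {l : List ℕ} (h : Good l) (h3 : ∀ y ∈ l.head?, 3 ≤ y) :
    ∃ l', Good l' ∧ l'.map (· + 3) = l := by
  obtain ⟨l', rfl⟩ : ∃ l' : List ℕ, l'.map (· + 3) = l := by
    refine exists_map_add ?_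
    cases l with
    | nil => simp
    | cons x l =>
      intro y hy
      have := h.le_of_mem y hy
      have := h3 x rfl
      omega
  exact ⟨l', (good_map_add_three l').1 h, rfl⟩

theorem goodGE_add_three (t : ℕ) : goodGE (t + 3) = List.map (· + 3) '' goodGE t := by
  ext l
  constructor
  · rintro ⟨h, ht⟩
    obtain ⟨l, hl, rfl⟩ := exists_good_map_add_three h fun y hy => by have := ht y hy; omega
    refine ⟨l, ⟨hl, fun y hy => ?_⟩, rfl⟩
    have := ht (y + 3) (by cases l <;> simp_all)
    omega
  · rintro ⟨l, ⟨hl, ht⟩, rfl⟩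
    refine ⟨(good_map_add_three l).2 hl, ?_⟩
    cases l <;> simp_all

theorem goodEQ_add_three (t : ℕ) : goodEQ (t + 3) = List.map (· + 3) '' goodEQ t := by
  ext l
  constructor
  · rintro ⟨h, ht⟩
    obtain ⟨l, hl, rfl⟩ := exists_good_map_add_three h fun y hy => by
      rw [ht] at hy; cases hy; omega
    refine ⟨l, ⟨hl, ?_⟩, rfl⟩
    cases l <;> simp_all
  · rintro ⟨l, ⟨hl, ht⟩, rfl⟩
    refine ⟨(good_map_add_three l).2 hl, ?_⟩
    cases l <;> simp_all

theorem goodGE_eq_union (t : ℕ) : goodGE t = goodEQ t ∪ goodGE (t + 1) := by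
  ext l
  cases l with
  | nil => simp [goodGE, goodEQ]
  | cons x l =>
    simp only [goodGE, goodEQ, Set.mem_union, Set.mem_ofPred_eq, List.head?_cons,
      Option.mem_some_iff, forall_eq', Option.some.injEq, ← and_or_left]
    refine and_congr_right fun _ => ?_
    omega

theorem disjoint_goodEQ_goodGE {t u : ℕ} (h : t < u) : Disjoint (goodEQ t) (goodGE u) := by
  refine Set.disjoint_left.2 ?_
  rintro l ⟨-, hl⟩ ⟨-, hu⟩
  have := hu t hl
  omega

theorem goodEQ_eq_cons (t : ℕ) : goodEQ t = List.cons t '' {l | Good (t :: l)} := by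
  ext l
  cases l with
  | nil => simp [goodEQ]
  | cons x l =>
    simp only [goodEQ, List.head?_cons, Set.mem_ofPred_eq, Set.mem_image, List.cons.injEq]
    constructor
    · rintro ⟨h, h'⟩
      cases h'
      exact ⟨l, h, rfl, rfl⟩
    · rintro ⟨l, h, rfl, rfl⟩
      exact ⟨h, rfl⟩

theorem good_one_cons : {l | Good (1 :: l)} = goodEQ 3 ∪ goodGE 5 := by
  ext l
  rcases l with _ | ⟨x, _ | ⟨y, l⟩⟩
  · simp [goodEQ, goodGE, Good]
  · simp [goodEQ, goodGE, Good, Adm]; omega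
  · simp only [Set.mem_ofPred_eq, Set.mem_union, goodEQ, goodGE, Good, Adm, List.head?_cons,
      Option.mem_some_iff, forall_eq', Option.some.injEq, ← and_or_left]
    grind

theorem good_three_cons : {l | Good (3 :: l)} = goodEQ 6 ∪ goodGE 8 := by
  ext l
  rcases l with _ | ⟨x, _ | ⟨y, l⟩⟩
  · simp [goodEQ, goodGE, Good]
  · simp [goodEQ, goodGE, Good, Adm]; omega
  · simp only [Set.mem_ofPred_eq, Set.mem_union, goodEQ, goodGE, Good, Adm, List.head?_cons,
      Option.mem_some_iff, forall_eq', Option.some.injEq, ← and_or_left]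
    grind

theorem cons_mem_image_cons {a x : ℕ} {l : List ℕ} {P : Set (List ℕ)} :
    x :: l ∈ List.cons a '' P ↔ x = a ∧ l ∈ P := by
  simp only [Set.mem_image, List.cons.injEq]
  constructor
  · rintro ⟨l, h, rfl, rfl⟩
    exact ⟨rfl, h⟩
  · rintro ⟨rfl, h⟩
    exact ⟨l, h, rfl, rfl⟩

/-- Here the triple condition has force: it forbids 2, 4, 6, so a 4 after 2 must be followed by at
least 8. After 1 or 3 it is implied by the gap-5 condition, which already rules out 3, 5. -/
theorem good_two_cons : {l | Good (2 :: l)} = List.cons 4 '' goodGE 8 ∪ goodGE 6 := by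
  ext l
  rcases l with _ | ⟨x, _ | ⟨y, l⟩⟩
  · simp [goodGE, Good]
  · simp [goodGE, Good, Adm]; omega
  · simp only [cons_mem_image_cons, Set.mem_ofPred_eq, Set.mem_union, goodGE, Good, Adm,
      List.head?_cons, Option.mem_some_iff, forall_eq']
    grind

/-! ### The closed form as a power series -/

theorem one_sub_X_pow_ne_zero {n : ℕ} (hn : n ≠ 0) : (1 - X ^ n : ℤ⟦X⟧) ≠ 0 := by
  intro h
  simpa [hn] using congrArg constantCoeff h

theorem one_add_X_pow_ne_zero (n : ℕ) : (1 + X ^ n : ℤ⟦X⟧) ≠ 0 := by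
  intro h
  rcases eq_or_ne n 0 with rfl | hn
  · have := congrArg constantCoeff h
    rw [pow_zero, map_add, map_one, map_zero] at this
    omega
  · simpa [hn] using congrArg constantCoeff h

/-- The generating function of the sets of `n` integers congruent to `r` modulo `d` that are at
least `r`. -/
noncomputable def progTerm (d r : ℕ) : ℕ → ℤ⟦X⟧
  | 0 => 1
  | n + 1 => X ^ (d * n + r) * progTerm d r n * invOfUnit (1 - X ^ (d * (n + 1))) 1

theorem progTerm_succ {d : ℕ} (hd : d ≠ 0) (r n : ℕ) :
    (1 - X ^ (d * (n + 1))) * progTerm d r (n + 1) = X ^ (d * n + r) * progTerm d r n := by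
  have h : (1 - X ^ (d * (n + 1)) : ℤ⟦X⟧) * invOfUnit (1 - X ^ (d * (n + 1))) 1 = 1 :=
    mul_invOfUnit _ _ (by simp [hd])
  rw [progTerm]
  linear_combination (X ^ (d * n + r) * progTerm d r n) * h

/-- The product of `1 + X ^ (3 * t)` for `1 ≤ t ≤ m`. -/
noncomputable def oneAddProd (m : ℕ) : ℤ⟦X⟧ :=
  ∏ t ∈ Finset.range m, (1 + X ^ (3 * (t + 1)))

theorem oneAddProd_succ (m : ℕ) :
    oneAddProd (m + 1) = (1 + X ^ (3 * (m + 1))) * oneAddProd m := by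
  rw [oneAddProd, Finset.prod_range_succ, mul_comm]; rfl

/-- The closed form of the generating function of the lists counted by `C*` with `i`, `j`, `k`
entries congruent to `1`, `2`, `0` modulo `3`. -/
noncomputable def closedForm (i j k : ℕ) : ℤ⟦X⟧ :=
  progTerm 6 4 i * progTerm 6 2 j * progTerm 3 3 k * oneAddProd (i + j) * X ^ (3 * k * (i + j))

section ClosedForm

variable (i j k : ℕ)

theorem closedForm_succ_left : (1 - X ^ (6 * (i + 1))) * closedForm (i + 1) j k =
    X ^ (6 * i + 4 + 3 * k) * (1 + X ^ (3 * (i + j + 1))) * closedForm i j k := by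
  have h := progTerm_succ (d := 6) (by norm_num) 4 i
  have hP := oneAddProd_succ (i + j)
  rw [closedForm, closedForm, show i + 1 + j = i + j + 1 by ring, hP]
  linear_combination (progTerm 6 2 j * progTerm 3 3 k * (1 + X ^ (3 * (i + j + 1))) *
    oneAddProd (i + j) * X ^ (3 * k * (i + j + 1))) * h

theorem closedForm_succ_middle : (1 - X ^ (6 * (j + 1))) * closedForm i (j + 1) k =
    X ^ (6 * j + 2 + 3 * k) * (1 + X ^ (3 * (i + j + 1))) * closedForm i j k := by
  have h := progTerm_succ (d := 6) (by norm_num) 2 j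
  have hP := oneAddProd_succ (i + j)
  rw [closedForm, closedForm, show i + (j + 1) = i + j + 1 by ring, hP]
  linear_combination (progTerm 6 4 i * progTerm 3 3 k * (1 + X ^ (3 * (i + j + 1))) *
    oneAddProd (i + j) * X ^ (3 * k * (i + j + 1))) * h

theorem closedForm_succ_right : (1 - X ^ (3 * (k + 1))) * closedForm i j (k + 1) =
    X ^ (3 * (i + j + k + 1)) * closedForm i j k := by
  have h := progTerm_succ (d := 3) (by norm_num) 3 k
  rw [closedForm, closedForm]
  linear_combination (progTerm 6 4 i * progTerm 6 2 j *
    oneAddProd (i + j) * X ^ (3 * (k + 1) * (i + j))) * h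

end ClosedForm

/-! ### Recurrences for the C* side and their solution -/

section Recurrences

variable (i j k : ℕ)

theorem gf_goodGE_add_three (t : ℕ) :
    gf (goodGE (t + 3)) i j k = X ^ (3 * (i + j + k)) * gf (goodGE t) i j k := by
  rw [goodGE_add_three, gf_shift _ dvd_rfl]

theorem gf_goodEQ_add_three (t : ℕ) :
    gf (goodEQ (t + 3)) i j k = X ^ (3 * (i + j + k)) * gf (goodEQ t) i j k := by
  rw [goodEQ_add_three, gf_shift _ dvd_rfl]

theorem gf_goodGE_eq_add (t : ℕ) :
    gf (goodGE t) i j k = gf (goodEQ t) i j k + gf (goodGE (t + 1)) i j k := by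
  conv_lhs => rw [goodGE_eq_union, gf_union (disjoint_goodEQ_goodGE (Nat.lt_succ_self t))]

/-- Once smallest parts 2 and 3 are split off, the lists starting at 4 or more are translates of
those starting at 1 or more. The forbidden part 1 thus enters as a stand-in for smallest part 4. -/
theorem gf_goodGE_two : (1 - X ^ (3 * (i + j + k))) * gf (goodGE 2) i j k =
    gf (goodEQ 2) i j k + gf (goodEQ 3) i j k +
      X ^ (3 * (i + j + k)) * gf (goodEQ 1) i j k := by
  have h1 := gf_goodGE_eq_add i j k 1
  have h2 := gf_goodGE_eq_add i j k 2
  have h3 := gf_goodGE_eq_add i j k 3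
  have h4 := gf_goodGE_add_three i j k 1
  linear_combination h2 + h3 + h4 + X ^ (3 * (i + j + k)) * h1

theorem gf_goodEQ_one_zero : gf (goodEQ 1) 0 j k = 0 := by
  rw [goodEQ_eq_cons, gf_cons_one_zero _ _ _ rfl]

theorem gf_goodEQ_one_succ : gf (goodEQ 1) (i + 1) j k =
    X * (gf (goodEQ 3) i j k + X ^ (3 * (i + j + k)) * gf (goodGE 2) i j k) := by
  rw [goodEQ_eq_cons, gf_cons_one _ _ _ _ rfl, good_one_cons,
    gf_union (disjoint_goodEQ_goodGE (by norm_num)), gf_goodGE_add_three, pow_one]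

theorem gf_goodEQ_three_zero : gf (goodEQ 3) i j 0 = 0 := by
  rw [goodEQ_eq_cons, gf_cons_three_zero _ _ _ rfl]

theorem gf_goodEQ_three_succ : gf (goodEQ 3) i j (k + 1) =
    X ^ 3 * (X ^ (3 * (i + j + k)) * gf (goodEQ 3) i j k +
      X ^ (6 * (i + j + k)) * gf (goodGE 2) i j k) := by
  conv_lhs => rw [goodEQ_eq_cons, gf_cons_three _ _ _ _ rfl, good_three_cons]
  rw [gf_union (disjoint_goodEQ_goodGE (by norm_num)), gf_goodEQ_add_three i j k 3,
    gf_goodGE_add_three i j k 5, gf_goodGE_add_three i j k 2, ← mul_assoc (X ^ (3 * (i + j + k))),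
    ← pow_add, ← add_mul]

theorem gf_goodEQ_two_zero : gf (goodEQ 2) i 0 k = 0 := by
  rw [goodEQ_eq_cons, gf_cons_two_zero _ _ _ rfl]

/-- `goodGE 6` is a translate of `goodGE 3`, which is `goodGE 2` without smallest part 2; hence the
difference. -/
theorem gf_goodEQ_two_succ : gf (goodEQ 2) i (j + 1) k =
    X ^ 2 * (gf (List.cons 4 '' goodGE 8) i j k +
      X ^ (3 * (i + j + k)) * (gf (goodGE 2) i j k - gf (goodEQ 2) i j k)) := by
  have hd : Disjoint (List.cons 4 '' goodGE 8) (goodGE 6) := by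
    refine Set.disjoint_left.2 ?_
    rintro _ ⟨l, -, rfl⟩ ⟨-, h⟩
    have := h 4 rfl
    omega
  conv_lhs => rw [goodEQ_eq_cons, gf_cons_two _ _ _ _ rfl, good_two_cons, gf_union hd,
    gf_goodGE_add_three i j k 3]
  rw [gf_goodGE_eq_add i j k 2, add_sub_cancel_left]

theorem gf_cons_four_zero : gf (List.cons 4 '' goodGE 8) 0 j k = 0 :=
  gf_cons_one_zero _ _ _ rfl

theorem gf_cons_four_succ : gf (List.cons 4 '' goodGE 8) (i + 1) j k =
    X ^ (4 + 6 * (i + j + k)) * gf (goodGE 2) i j k := by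
  rw [gf_cons_one _ _ _ _ rfl, gf_goodGE_add_three i j k 5, gf_goodGE_add_three i j k 2]
  ring

end Recurrences

/-- The recurrences couple these three series, so they are proved together by induction on the
number of parts. The factor 1 + X^(3(i+j)) in the third clears a denominator. -/
theorem gf_good_eq_closedForm (s : ℕ) : ∀ i j k, i + j + k = s →
    gf (goodGE 2) i j k = closedForm i j k ∧
    gf (goodEQ 3) i j k = X ^ (3 * (i + j)) * (1 - X ^ (3 * k)) * closedForm i j k ∧
    (1 + X ^ (3 * (i + j))) * gf (goodEQ 2) i j k = (1 - X ^ (6 * j)) * closedForm i j k := by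
  induction s using Nat.strong_induction_on with | _ s ih
  intro i j k h
  rcases Nat.eq_zero_or_pos s with rfl | hs
  · obtain ⟨rfl, rfl, rfl⟩ : i = 0 ∧ j = 0 ∧ k = 0 := by omega
    have : gf (goodGE 2) 0 0 0 = 1 := gf_zero (by simp [goodGE, Good])
    rw [this, gf_goodEQ_three_zero, gf_goodEQ_two_zero]
    simp [closedForm, progTerm, oneAddProd]
  -- The extra power of X translates smallest part 1 to smallest part 4, the form needed in
  -- `gf_goodGE_two`.
  · have hone : (1 + X ^ (3 * (i + j))) * X ^ (3 * (i + j + k)) * gf (goodEQ 1) i j k =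
        X ^ (6 * j) * (1 - X ^ (6 * i)) * closedForm i j k := by
      cases i with
      | zero => simp [gf_goodEQ_one_zero]
      | succ i =>
        obtain ⟨hH, hC, -⟩ := ih _ (by omega) i j k rfl
        rw [gf_goodEQ_one_succ, hH, hC]
        linear_combination (-X ^ (6 * j)) * closedForm_succ_left i j k
    have hthree : gf (goodEQ 3) i j k =
        X ^ (3 * (i + j)) * (1 - X ^ (3 * k)) * closedForm i j k := by
      cases k with
      | zero => simp [gf_goodEQ_three_zero]
      | succ k =>
        obtain ⟨hH, hC, -⟩ := ih _ (by omega) i j k rfl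
        rw [gf_goodEQ_three_succ, hH, hC]
        linear_combination (-X ^ (3 * (i + j))) * closedForm_succ_right i j k
    have htwo : (1 + X ^ (3 * (i + j))) * gf (goodEQ 2) i j k =
        (1 - X ^ (6 * j)) * closedForm i j k := by
      cases j with
      | zero => simp [gf_goodEQ_two_zero]
      | succ j =>
        obtain ⟨hH, -, hB⟩ := ih _ (by omega) i j k rfl
        have hK : (1 + X ^ (3 * (i + j))) * gf (List.cons 4 '' goodGE 8) i j k =
            X ^ (6 * j + 3 * k) * (1 - X ^ (6 * i)) * closedForm i j k := by
          cases i with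
          | zero => simp [gf_cons_four_zero]
          | succ i =>
            obtain ⟨hH, -, -⟩ := ih _ (by omega) i j k rfl
            rw [gf_cons_four_succ, hH]
            linear_combination (-X ^ (6 * j + 3 * k)) * closedForm_succ_left i j k
        refine mul_left_cancel₀ (one_add_X_pow_ne_zero (3 * (i + j))) ?_
        rw [gf_goodEQ_two_succ, hH]
        linear_combination (1 + X ^ (3 * (i + (j + 1)))) * X ^ 2 * hK -
          (1 + X ^ (3 * (i + (j + 1)))) * X ^ (2 + 3 * (i + j + k)) * hB -
          (1 + X ^ (3 * (i + j))) * closedForm_succ_middle i j k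
    refine ⟨?_, hthree, htwo⟩
    refine mul_left_cancel₀ (one_sub_X_pow_ne_zero (n := 3 * (i + j + k)) (by omega))
      (mul_left_cancel₀ (one_add_X_pow_ne_zero (3 * (i + j))) ?_)
    have hG := gf_goodGE_two i j k
    rw [hthree] at hG
    -- With q = X^3, m = i + j: (1 - q^(2j)) + q^(2j)(1 - q^(2i)) + (1 + q^m) q^m (1 - q^k) = (1 +
    -- q^m)(1 - q^(m+k)).
    linear_combination (1 + X ^ (3 * (i + j))) * hG + htwo + hone

/-! ### The D side -/

/-- The strictly increasing lists whose entries are at least `t` and not congruent to `± 1`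
modulo `6`. -/
def distinctGE (t : ℕ) : Set (List ℕ) :=
  {l | l.Pairwise (· < ·) ∧ ∀ x ∈ l, t ≤ x ∧ x % 6 ≠ 1 ∧ x % 6 ≠ 5}

theorem distinctGE_eq_union {t : ℕ} (h1 : t % 6 ≠ 1) (h5 : t % 6 ≠ 5) :
    distinctGE t = List.cons t '' distinctGE (t + 1) ∪ distinctGE (t + 1) := by
  ext l
  rcases l with _ | ⟨x, l⟩
  · simp [distinctGE]
  · simp only [Set.mem_union, cons_mem_image_cons, distinctGE, Set.mem_ofPred_eq,
      List.pairwise_cons, List.forall_mem_cons]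
    constructor
    · rintro ⟨⟨hx, hl⟩, hxt, h⟩
      rcases eq_or_lt_of_le hxt.1 with rfl | hlt
      · exact Or.inl ⟨rfl, hl, fun y hy => ⟨hx y hy, (h y hy).2⟩⟩
      · exact Or.inr ⟨⟨hx, hl⟩, ⟨hlt, hxt.2⟩, fun y hy => ⟨hlt.trans (hx y hy), (h y hy).2⟩⟩
    · rintro (⟨rfl, hl, h⟩ | ⟨hl, hx, h⟩)
      · exact ⟨⟨fun y hy => (h y hy).1, hl⟩, ⟨le_rfl, h1, h5⟩,
          fun y hy => ⟨Nat.le_of_succ_le (h y hy).1, (h y hy).2⟩⟩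
      · exact ⟨hl, ⟨Nat.le_of_succ_le hx.1, hx.2⟩,
          fun y hy => ⟨Nat.le_of_succ_le (h y hy).1, (h y hy).2⟩⟩

theorem distinctGE_succ {t : ℕ} (ht : t % 6 = 1 ∨ t % 6 = 5) :
    distinctGE (t + 1) = distinctGE t := by
  ext l
  refine and_congr_right fun _ => forall₂_congr fun x _ => ?_
  have : x = t → x % 6 = t % 6 := congrArg (· % 6)
  omega

theorem distinctGE_add_six (t : ℕ) : distinctGE (t + 6) = List.map (· + 6) '' distinctGE t := by
  have key : ∀ l : List ℕ, l.map (· + 6) ∈ distinctGE (t + 6) ↔ l ∈ distinctGE t := by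
    intro l
    simp [distinctGE, List.pairwise_map]
  ext l
  constructor
  · intro h
    obtain ⟨l, rfl⟩ := exists_map_add (d := 6) fun x hx => by
      have := (h.2 x hx).1
      omega
    exact ⟨l, (key l).1 h, rfl⟩
  · rintro ⟨l, h, rfl⟩
    exact (key l).2 h

theorem gf_distinctGE_eq_add {t : ℕ} (h1 : t % 6 ≠ 1) (h5 : t % 6 ≠ 5) (i j k : ℕ) :
    gf (distinctGE t) i j k =
      gf (List.cons t '' distinctGE (t + 1)) i j k + gf (distinctGE (t + 1)) i j k := by
  rw [← gf_union, ← distinctGE_eq_union h1 h5]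
  refine Set.disjoint_left.2 ?_
  rintro _ ⟨l, -, rfl⟩ ⟨-, h⟩
  have := (h t List.mem_cons_self).1
  omega

theorem gf_distinctGE_seven (i j k : ℕ) :
    gf (distinctGE 7) i j k = X ^ (6 * (i + j + k)) * gf (distinctGE 2) i j k := by
  rw [← distinctGE_succ (t := 7) (Or.inl rfl), distinctGE_add_six, gf_shift _ (by norm_num)]

/-- One period of 6 is traversed through the allowed smallest parts 2, 3, 4, 6. Abstracting the
product as `T` keeps it an atom for `linear_combination`. -/
theorem gf_distinctGE_eq_progTerm (s : ℕ) : ∀ i j k, i + j + k = s → ∀ T,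
    T = progTerm 6 4 i * progTerm 6 2 j * progTerm 3 3 k →
    gf (distinctGE 2) i j k = T ∧
    gf (distinctGE 3) i j k = X ^ (6 * j) * T ∧
    gf (distinctGE 4) i j k = X ^ (6 * j + 3 * k) * T ∧
    gf (distinctGE 5) i j k = X ^ (6 * j + 3 * k + 6 * i) * T := by
  induction s using Nat.strong_induction_on with | _ s ih
  intro i j k h T hT
  have h2 : gf (List.cons 2 '' distinctGE 3) i j k = (1 - X ^ (6 * j)) * T := by
    cases j with
    | zero => simp [gf_cons_two_zero]
    | succ j =>
      obtain ⟨-, h, -, -⟩ := ih _ (by omega) i j k rfl _ rfl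
      rw [gf_cons_two _ _ _ _ rfl, h, hT]
      linear_combination (-progTerm 6 4 i * progTerm 3 3 k) *
        progTerm_succ (d := 6) (by norm_num) 2 j
  have h3 : gf (List.cons 3 '' distinctGE 4) i j k = X ^ (6 * j) * (1 - X ^ (3 * k)) * T := by
    cases k with
    | zero => simp [gf_cons_three_zero]
    | succ k =>
      obtain ⟨-, -, h, -⟩ := ih _ (by omega) i j k rfl _ rfl
      rw [gf_cons_three _ _ _ _ rfl, h, hT]
      linear_combination (-progTerm 6 4 i * progTerm 6 2 j * X ^ (6 * j)) *
        progTerm_succ (d := 3) (by norm_num) 3 k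
  have h4 : gf (List.cons 4 '' distinctGE 5) i j k =
      X ^ (6 * j + 3 * k) * (1 - X ^ (6 * i)) * T := by
    cases i with
    | zero => simp [gf_cons_one_zero]
    | succ i =>
      obtain ⟨-, -, -, h⟩ := ih _ (by omega) i j k rfl _ rfl
      rw [gf_cons_one _ _ _ _ rfl, h, hT]
      linear_combination (-progTerm 3 3 k * progTerm 6 2 j * X ^ (6 * j + 3 * k)) *
        progTerm_succ (d := 6) (by norm_num) 4 i
  have h6 : gf (List.cons 6 '' distinctGE 7) i j k =
      X ^ (6 * j + 3 * k + 6 * i) * (1 - X ^ (3 * k)) * T := by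
    cases k with
    | zero => simp [gf_cons_three_zero]
    | succ k =>
      obtain ⟨h, -, -, -⟩ := ih _ (by omega) i j k rfl _ rfl
      rw [gf_cons_three _ _ _ _ rfl, gf_distinctGE_seven, h, hT]
      linear_combination (-progTerm 6 4 i * progTerm 6 2 j * X ^ (6 * j + 3 * (k + 1) + 6 * i)) *
        progTerm_succ (d := 3) (by norm_num) 3 k
  have e2 := gf_distinctGE_eq_add (t := 2) (by norm_num) (by norm_num) i j k
  have e3 := gf_distinctGE_eq_add (t := 3) (by norm_num) (by norm_num) i j k
  have e4 := gf_distinctGE_eq_add (t := 4) (by norm_num) (by norm_num) i j k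
  have e6 := gf_distinctGE_eq_add (t := 6) (by norm_num) (by norm_num) i j k
  rw [distinctGE_succ (t := 5) (Or.inr rfl), gf_distinctGE_seven] at e6
  have main : gf (distinctGE 2) i j k = T := by
    rcases Nat.eq_zero_or_pos s with rfl | hs
    · obtain ⟨rfl, rfl, rfl⟩ : i = 0 ∧ j = 0 ∧ k = 0 := by omega
      rw [gf_zero (by simp [distinctGE]), hT]
      simp [progTerm]
    · refine mul_left_cancel₀ (one_sub_X_pow_ne_zero (n := 6 * (i + j + k)) (by omega)) ?_
      -- The four contributions telescope to 1 - X^(6(i+j+k)); the multiples of 3 count twice per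
      -- period, for 3 and for 6.
      linear_combination e2 + e3 + e4 + e6 + h2 + h3 + h4 + h6
  refine ⟨main, ?_, ?_, ?_⟩
  · linear_combination main - e2 - h2
  · linear_combination main - e2 - h2 - e3 - h3
  · linear_combination main - e2 - h2 - e3 - h3 - e4 - h4

/-! ### Summation over the number of multiples of 3 -/

/-- Truncated form of `(1 + q ^ (m + 1)) * (-q ^ (m + 2); q) = (-q ^ (m + 1); q)` in `q = X ^ 3`. -/
theorem one_add_mul_sum_progTerm (m N : ℕ) :
    (1 + X ^ (3 * (m + 1))) * ∑ k ∈ Finset.range N, X ^ (3 * k * (m + 1)) * progTerm 3 3 k -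
      ∑ k ∈ Finset.range N, X ^ (3 * k * m) * progTerm 3 3 k =
    X ^ (3 * N * m) * ((1 - X ^ (3 * N)) * progTerm 3 3 N) := by
  induction N with
  | zero => simp
  | succ N ih =>
    rw [Finset.sum_range_succ, Finset.sum_range_succ, progTerm_succ (by norm_num)]
    linear_combination ih

theorem X_pow_dvd_oneAddProd_mul_sum_sub (m N : ℕ) :
    (X ^ N : ℤ⟦X⟧) ∣ oneAddProd m * ∑ k ∈ Finset.range N, X ^ (3 * k * m) * progTerm 3 3 k -
      ∑ k ∈ Finset.range N, progTerm 3 3 k := by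
  induction m with
  | zero => simp [oneAddProd]
  | succ m ih =>
    have h : (X ^ N : ℤ⟦X⟧) ∣ (1 - X ^ (3 * N)) * progTerm 3 3 N := by
      cases N with
      | zero => simp
      | succ N =>
        rw [progTerm_succ (by norm_num)]
        exact (pow_dvd_pow X (by omega)).mul_right _
    have := dvd_add ih ((h.mul_left (X ^ (3 * N * m))).mul_left (oneAddProd m))
    rw [← one_add_mul_sum_progTerm] at this
    rw [oneAddProd_succ]
    convert this using 1
    ring

theorem sum_ncard_fiber_eq (i j n : ℕ) :
    ∑ k ∈ Finset.range (n + 1), (fiber (goodGE 2) i j k n).ncard =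
      ∑ k ∈ Finset.range (n + 1), (fiber (distinctGE 2) i j k n).ncard := by
  have h := (X_pow_dvd_oneAddProd_mul_sum_sub (i + j) (n + 1)).mul_left
    (progTerm 6 4 i * progTerm 6 2 j)
  have h1 : progTerm 6 4 i * progTerm 6 2 j * (oneAddProd (i + j) *
      ∑ k ∈ Finset.range (n + 1), X ^ (3 * k * (i + j)) * progTerm 3 3 k -
      ∑ k ∈ Finset.range (n + 1), progTerm 3 3 k) =
      ∑ k ∈ Finset.range (n + 1), gf (goodGE 2) i j k -
        ∑ k ∈ Finset.range (n + 1), gf (distinctGE 2) i j k := by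
    rw [mul_sub, Finset.mul_sum, Finset.mul_sum, Finset.mul_sum]
    congr 1
    · refine Finset.sum_congr rfl fun k _ => ?_
      rw [(gf_good_eq_closedForm _ i j k rfl).1, closedForm]
      ring
    · refine Finset.sum_congr rfl fun k _ => ?_
      rw [(gf_distinctGE_eq_progTerm _ i j k rfl _ rfl).1]
  rw [h1, X_pow_dvd_iff] at h
  have := h n (Nat.lt_succ_self n)
  rw [map_sub, map_sum, map_sum, sub_eq_zero] at this
  simp only [gf, coeff_mk] at this
  exact_mod_cast this

/-! ### From lists back to partitions -/

theorem ncard_eq_sum_fiber {P : Set (List ℕ)} (hP : ∀ l ∈ P, ∀ x ∈ l, 1 ≤ x) (i j n : ℕ) :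
    {l | l ∈ P ∧ l.sum = n ∧ residueCount 1 l = i ∧ residueCount 2 l = j}.ncard =
      ∑ k ∈ Finset.range (n + 1), (fiber P i j k n).ncard := by
  have hU : {l | l ∈ P ∧ l.sum = n ∧ residueCount 1 l = i ∧ residueCount 2 l = j} =
      ⋃ k ∈ Finset.range (n + 1), fiber P i j k n := by
    ext l
    simp only [Set.mem_ofPred_eq, Set.mem_iUnion, Finset.mem_range, exists_prop]
    constructor
    · rintro ⟨hl, hn, hi, hj⟩
      refine ⟨residueCount 0 l, ?_, hl, hn, hi, hj, rfl⟩
      -- Positive parts force `k ≤ n`, so the range `n + 1` loses nothing.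
      have h1 : l.length ≤ l.sum := List.length_le_sum_of_one_le l (hP l hl)
      have h2 := length_eq_residueCount l
      omega
    · rintro ⟨k, -, hl, hn, hi, hj, -⟩
      exact ⟨hl, hn, hi, hj⟩
  have hd : ((Finset.range (n + 1) : Finset ℕ) : Set ℕ).PairwiseDisjoint
      fun k => fiber P i j k n := by
    intro a _ b _ hab
    refine Set.disjoint_left.2 fun l ha hb => hab ?_
    rw [← ha.2.2.2.2, ← hb.2.2.2.2]
  rw [hU, ← finsum_mem_coe_finset,
    ← (Finset.finite_toSet _).ncard_biUnion (fun _ _ => finite_fiber _ _ _ _ _) hd]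
  rfl

theorem sort_reverse_eq_descParts {n : ℕ} (p : n.Partition) :
    (p.parts.sort (· ≤ ·)).reverse = descParts p := by
  refine List.Perm.eq_of_pairwise' (r := (· ≥ ·)) ?_ (Multiset.pairwise_sort _ _) ?_
  · exact List.pairwise_reverse.2 (Multiset.pairwise_sort _ _)
  · rw [← Multiset.coe_eq_coe, descParts, Multiset.coe_reverse, Multiset.sort_eq,
      Multiset.sort_eq]

theorem ncard_partition_eq {n : ℕ} {Q : n.Partition → Prop} {P : Set (List ℕ)}
    (hQ : ∀ p, Q p ↔ p.parts.sort (· ≤ ·) ∈ P)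
    (hP : ∀ l ∈ P, l.Pairwise (· < ·) ∧ ∀ x ∈ l, 1 ≤ x) (i j : ℕ) :
    Nat.card {p : n.Partition // Q p ∧ numPartsMod3 1 p = i ∧ numPartsMod3 2 p = j} =
      ∑ k ∈ Finset.range (n + 1), (fiber P i j k n).ncard := by
  have hcount : ∀ r (p : n.Partition),
      numPartsMod3 r p = residueCount r (p.parts.sort (· ≤ ·)) := by
    intro r p
    rw [numPartsMod3, residueCount, ← Multiset.coe_countP, Multiset.sort_eq]
  have hinj : Function.Injective fun p : n.Partition => p.parts.sort (· ≤ ·) := by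
    intro p q h
    ext1
    rw [← Multiset.sort_eq p.parts (· ≤ ·), ← Multiset.sort_eq q.parts (· ≤ ·)]
    exact congrArg _ h
  rw [← ncard_eq_sum_fiber (fun l hl => (hP l hl).2)]
  change Nat.card {p | Q p ∧ numPartsMod3 1 p = i ∧ numPartsMod3 2 p = j} = _
  rw [Nat.card_coe_set_eq, ← Set.ncard_image_of_injective _ hinj]
  congr 1
  ext l
  constructor
  · rintro ⟨p, ⟨hp, hi, hj⟩, rfl⟩
    refine ⟨(hQ p).1 hp, ?_, (hcount 1 p).symm.trans hi, (hcount 2 p).symm.trans hj⟩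
    simp only
    rw [← Multiset.sum_coe, Multiset.sort_eq, p.parts_sum]
  · rintro ⟨hl, hn, hi, hj⟩
    let p : n.Partition := ⟨l, fun hx => (hP l hl).2 _ hx, by rw [Multiset.sum_coe, hn]⟩
    have hp : p.parts.sort (· ≤ ·) = l := by
      refine List.Perm.eq_of_pairwise' (r := (· ≤ ·)) (Multiset.pairwise_sort _ _)
        ((hP l hl).1.imp le_of_lt) ?_
      rw [← Multiset.coe_eq_coe, Multiset.sort_eq]
    exact ⟨p, ⟨(hQ p).2 (hp ▸ hl), by rw [hcount, hp, hi], by rw [hcount, hp, hj]⟩, hp⟩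

theorem good_iff_infix (l : List ℕ) : Good l ↔ (∀ x y, [y, x] <:+: l → Adm y x) ∧
    ∀ x y z, [z, y, x] <:+: l → ¬ (x = y + 2 ∧ y = z + 2) := by
  induction l with
  | nil => simp [Good]
  | cons a l ih =>
    cases l with
    | nil => simp [Good, List.infix_cons_iff]
    | cons b l =>
      rw [Good, ih]
      simp only [List.infix_cons_iff (l₂ := b :: l), List.cons_prefix_cons]
      have hz : ∀ z, [z] <+: l ↔ z ∈ l.head? := fun z => by
        cases l <;> simp [List.cons_prefix_cons, eq_comm]
      simp only [hz, List.nil_prefix, and_true]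
      constructor
      · rintro ⟨h1, h2, h3, h4⟩
        refine ⟨?_, ?_⟩
        · rintro x y (⟨rfl, rfl⟩ | h)
          exacts [h1, h3 x y h]
        · rintro x y z (⟨rfl, rfl, h⟩ | h)
          exacts [fun hx => h2 x h ⟨hx.2, hx.1⟩, h4 x y z h]
      · rintro ⟨h1, h2⟩
        exact ⟨h1 b a (Or.inl ⟨rfl, rfl⟩), fun z hz hx => h2 z b a (Or.inl ⟨rfl, rfl, hz⟩) hx.symm,
          fun x y h => h1 x y (Or.inr h), fun x y z h => h2 x y z (Or.inr h)⟩

theorem isCStar_iff {n : ℕ} (p : n.Partition) :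
    IsCStar p ↔ p.parts.sort (· ≤ ·) ∈ goodGE 2 := by
  have hr : ∀ l : List ℕ, l <:+: descParts p ↔ l.reverse <:+: p.parts.sort (· ≤ ·) := by
    intro l
    rw [← sort_reverse_eq_descParts, ← List.reverse_infix, List.reverse_reverse]
  have hg := good_iff_infix (p.parts.sort (· ≤ ·))
  constructor
  · intro h
    refine ⟨hg.2 ⟨fun x y hxy => ⟨h.diff_ge_two x y ((hr _).2 hxy),
      h.diff_ge_five x y ((hr _).2 hxy)⟩, fun x y z hxyz => h.no_triple x y z ((hr _).2 hxyz)⟩, ?_⟩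
    intro y hy
    exact h.one_lt y ((Multiset.mem_sort _).1 (List.mem_of_mem_head? hy))
  · rintro ⟨h, h2⟩
    obtain ⟨hA, hT⟩ := hg.1 h
    refine ⟨fun m hm => ?_, fun x y hxy => (hA x y ((hr _).1 hxy)).1,
      fun x y hxy => (hA x y ((hr _).1 hxy)).2, fun x y z h => hT x y z ((hr _).1 h)⟩
    rw [← Multiset.mem_sort (r := (· ≤ ·))] at hm
    generalize p.parts.sort (· ≤ ·) = l at *
    cases l with
    | nil => simp at hm
    | cons a l => exact (h2 a rfl).trans (h.le_of_mem m hm)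

theorem isD_iff {n : ℕ} (p : n.Partition) :
    IsD p ↔ p.parts.sort (· ≤ ·) ∈ distinctGE 2 := by
  have hs := Multiset.pairwise_sort p.parts (· ≤ ·)
  constructor
  · intro h
    have hnd : (p.parts.sort (· ≤ ·)).Nodup := by
      rw [← Multiset.coe_nodup, Multiset.sort_eq]; exact h.nodup
    refine ⟨(hs.and hnd).imp fun h => lt_of_le_of_ne h.1 h.2, fun x hx => ?_⟩
    rw [Multiset.mem_sort] at hx
    have h1 := h.not_one x hx
    have h5 := h.not_neg_one x hx
    have := p.parts_pos hx
    simp only [Nat.ModEq] at h1 h5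
    omega
  · rintro ⟨h, h'⟩
    refine ⟨?_, fun m hm => ?_, fun m hm => ?_⟩
    · rw [← Multiset.sort_eq p.parts (· ≤ ·), Multiset.coe_nodup]
      exact h.imp ne_of_lt
    · exact (h' m ((Multiset.mem_sort _).2 hm)).2.1
    · exact (h' m ((Multiset.mem_sort _).2 hm)).2.2

end Capparelli

theorem mainTheorem10 (n i j : ℕ) :
    Capparelli.cStar n i j = Capparelli.dCount n i j := by
  rw [Capparelli.cStar, Capparelli.dCount,
    Capparelli.ncard_partition_eq Capparelli.isCStar_iff fun l hl => ⟨?_, ?_⟩,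
    Capparelli.ncard_partition_eq Capparelli.isD_iff fun l hl =>
      ⟨hl.1, fun x hx => Nat.le_of_succ_le (hl.2 x hx).1⟩,
    Capparelli.sum_ncard_fiber_eq]
  · exact List.isChain_iff_pairwise.1 hl.1.isChain
  · cases l with
    | nil => simp
    | cons a l =>
      intro x hx
      have := hl.1.le_of_mem x hx
      have := hl.2 a rfl
      omega
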